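/- Let $R$ be a commutative ring and $t,w,v\in R$ (for example $R=\mathbb{Z}[t,w,v]$ with $t,w,v$ indeterminates). Put $c_2=t$, $c_3=w$, $c_7=v$, and $c_k=1$ for every other $k\ge 1$. Then the following identity (a $t,w,v$-refinement of the second Rogers–Ramanujan identity for the part sizes $2$, $3$ and $7$) holds in the ring of formal power series $R[[q]]$, where the infinite sum and the infinite product converge in the usual coefficientwise sense: $$ \begin{aligned} 1&+q^2\frac{t+wq}{1-tq^2}+q^6\frac{w^2+vq+q^2}{(1-tq^2)(1-wq^3)} +q^{12}\frac{1+q+v^2q^2+vq^3+q^4+q^5+q^6}{(1-tq^2)(1-wq^3)(1-vq^7)}\\ &+q^{20}\frac{1+q+q^2+q^3+q^4+q^5+q^6}{(1-tq^2)(1-wq^3)(1-q^4)(1-vq^7)}\\ &+q^{30}\frac{1+q+q^2+q^3+q^4+q^5+q^6}{(1-tq^2)(1-wq^3)(1-q^4)(1-q^5)(1-vq^7)}\\ &+q^{42}\frac{1+q+q^2+q^3+q^4+q^5+q^6}{(1-tq^2)(1-wq^3)(1-q^4)(1-q^5)(1-q^6)(1-vq^7)}\\ &+\sum_{m=7}^{\infty}\frac{q^{m(m+1)}}{\prod_{k=1}^{m}(1-c_kq^k)}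 =\frac{1}{\prod_{k=0}^{\infty}(1-c_{5k+2}\,q^{5k+2})(1-c_{5k+3}\,q^{5k+3})}. \end{aligned} $$ Thus the product on the right is $(1-tq^2)(1-wq^3)(1-vq^7)(1-q^8)(1-q^{12})(1-q^{13})\cdots$. -/

import Mathlib

open scoped PowerSeries PowerSeries.WithPiTopology

namespace RRWeighted

variable {R : Type*} [CommRing R]

/-- The quotient `a / b` of formal power series, for a denominator `b` whose constant
coefficient is `1` (so that `b` is a unit). -/
noncomputable def quo (a b : R⟦X⟧) : R⟦X⟧ :=
  a * PowerSeries.invOfUnit b 1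

/-- `quo a b` really is the quotient whenever `b` has constant coefficient `1`. -/
theorem quo_mul_cancel (a b : R⟦X⟧) (hb : PowerSeries.constantCoeff b = 1) :
    quo a b * b = a := by
  rw [quo, mul_assoc, PowerSeries.invOfUnit_mul b 1 (by simpa using hb), mul_one]

/-- The factor `1 - c q ^ k`, where `q` is the variable of the power series ring. -/
noncomputable def factor (c : R) (k : ℕ) : R⟦X⟧ :=
  1 - PowerSeries.C c * PowerSeries.X ^ k

/-- The weight of a part of size `k`: the parts `2`, `3`, `7` have weights `t`, `w`, `v`, and
all other parts have weight `1`. -/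
def partWeight (t w v : R) (k : ℕ) : R :=
  if k = 2 then t else if k = 3 then w else if k = 7 then v else 1

/-- The weighted analogue of `(1 - q) (1 - q ^ 2) ⋯ (1 - q ^ m)`, that is
`(1 - q) (1 - t q ^ 2) (1 - w q ^ 3) (1 - q ^ 4) (1 - q ^ 5) (1 - q ^ 6) (1 - v q ^ 7) ⋯`
up to the factor of index `m`. -/
noncomputable def weightedPoch (t w v : R) (m : ℕ) : R⟦X⟧ :=
  ∏ k ∈ Finset.Icc 1 m, factor (partWeight t w v k) k

/-- The term of index `m` of the tail: `q ^ (m (m + 1))` over the weighted product. -/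
noncomputable def tailTerm (t w v : R) (m : ℕ) : R⟦X⟧ :=
  quo (PowerSeries.X ^ (m * (m + 1))) (weightedPoch t w v m)

/-- The two factors of the product side that belong to the parts `5 k + 2` and `5 k + 3`. -/
noncomputable def productFactor (t w v : R) (k : ℕ) : R⟦X⟧ :=
  factor (partWeight t w v (5 * k + 2)) (5 * k + 2) *
    factor (partWeight t w v (5 * k + 3)) (5 * k + 3)

end RRWeighted

open PowerSeries RRWeighted

open Finset

/-! Multiplying by (1 - tq²)(1 - wq³)(1 - vq⁷) removes the weights: both sides become those of the
second Rogers–Ramanujan identity times (1 - q²)(1 - q³)(1 - q⁷). The only nonobvious point is the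
low-order terms (`headSum_mul_weightedFactors`).

The unweighted identity follows Rogers. The series G_k = ∑ q^(m² + (k+1)m)/(q)_m satisfy G_k =
G_(k+1) + q^(k+2) G_(k+2), and so do the alternating sums of `rogersTerm`, by telescoping. For large
k, G_k tends to 1 and the alternating sum to (q)_∞, so the latter is (q)_∞ G_k for every k
(`modX_sum_rogersTerm`). At k = 0 it is a Jacobi triple product, obtained from the finite q-binomial
theorem.

Everything is finite modulo X^M; limits enter only at the end. -/

namespace RRWeighted

/-! ### Gaussian binomials and the finite q-binomial theorem -/

section Gauss

variable {A : Type*} [CommRing A]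

/-- The product `(1 - q) (1 - q ^ 2) ⋯ (1 - q ^ n)`. -/
def qPoch (q : A) (n : ℕ) : A := ∏ i ∈ range n, (1 - q ^ (i + 1))

/-- The Gaussian binomial coefficient, defined by the `q`-Pascal rule. -/
def gaussBinom (q : A) : ℕ → ℕ → A
  | _, 0 => 1
  | 0, _ + 1 => 0
  | n + 1, k + 1 => gaussBinom q n k + q ^ (k + 1) * gaussBinom q n (k + 1)

@[simp] theorem qPoch_zero (q : A) : qPoch q 0 = 1 := by simp [qPoch]

theorem qPoch_succ (q : A) (n : ℕ) : qPoch q (n + 1) = qPoch q n * (1 - q ^ (n + 1)) := by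
  rw [qPoch, prod_range_succ, qPoch]

@[simp] theorem gaussBinom_zero_right (q : A) (n : ℕ) : gaussBinom q n 0 = 1 := by
  cases n <;> rfl

theorem gaussBinom_succ_succ (q : A) (n k : ℕ) :
    gaussBinom q (n + 1) (k + 1) = gaussBinom q n k + q ^ (k + 1) * gaussBinom q n (k + 1) := rfl

theorem gaussBinom_eq_zero_of_lt (q : A) (n k : ℕ) (h : n < k) : gaussBinom q n k = 0 := by
  induction n generalizing k with
  | zero => obtain ⟨k, rfl⟩ := Nat.exists_eq_succ_of_ne_zero h.ne'; rfl
  | succ n ih =>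
    obtain ⟨k, rfl⟩ := Nat.exists_eq_succ_of_ne_zero (Nat.ne_zero_of_lt h)
    rw [Nat.succ_eq_add_one, gaussBinom_succ_succ, ih k (by omega), ih (k + 1) (by omega)]
    simp

@[simp] theorem gaussBinom_self (q : A) (n : ℕ) : gaussBinom q n n = 1 := by
  induction n with
  | zero => rfl
  | succ n ih => simp [gaussBinom_succ_succ, ih, gaussBinom_eq_zero_of_lt q n (n + 1) (by omega)]

/-- Pascal's rule matches the splitting 1 - q^(i+j) = (1 - q^j) + q^j (1 - q^i); the induction is on
i + j. -/
theorem gaussBinom_mul_qPoch (q : A) (i j : ℕ) :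
    gaussBinom q (i + j) j * (qPoch q i * qPoch q j) = qPoch q (i + j) := by
  suffices ∀ s i j, i + j = s →
      gaussBinom q (i + j) j * (qPoch q i * qPoch q j) = qPoch q (i + j) from this _ i j rfl
  intro s
  induction s with
  | zero => intro i j h; obtain ⟨rfl, rfl⟩ : i = 0 ∧ j = 0 := by omega
            simp
  | succ s ih =>
    intro i j h
    rcases i with _ | i
    · simp
    rcases j with _ | j
    · simp
    have h1 := ih (i + 1) j (by omega)
    have h2 := ih i (j + 1) (by omega)
    rw [show i + (j + 1) = i + 1 + j by omega] at h2
    rw [← add_assoc, gaussBinom_succ_succ, qPoch_succ q (i + 1 + j)]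
    rw [qPoch_succ q j] at h2 ⊢
    rw [qPoch_succ q i] at h1 ⊢
    linear_combination (1 - q ^ (j + 1)) * h1 + q ^ (j + 1) * (1 - q ^ (i + 1)) * h2

theorem choose_two_succ (n : ℕ) : (n + 1).choose 2 = n.choose 2 + n := by
  rw [Nat.choose_succ_succ' n 1, Nat.choose_one_right, add_comm]

theorem choose_two_add (m n : ℕ) : (m + n).choose 2 = m.choose 2 + n.choose 2 + m * n := by
  induction n with
  | zero => simp
  | succ n ih => rw [← add_assoc, choose_two_succ, choose_two_succ, ih]; ring

/-- The finite `q`-binomial theorem, in homogeneous form. -/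
theorem prod_add_mul_pow (q a b : A) (n : ℕ) :
    ∏ i ∈ range n, (a + b * q ^ i) =
      ∑ j ∈ range (n + 1), q ^ j.choose 2 * gaussBinom q n j * a ^ (n - j) * b ^ j := by
  induction n generalizing b with
  | zero => simp
  | succ n ih =>
    -- Peeling off the factor i = 0 turns b into bq in the rest, which is why b is generalized.
    have h : ∏ i ∈ range n, (a + b * q ^ (i + 1)) = ∏ i ∈ range n, (a + b * q * q ^ i) :=
      prod_congr rfl fun i _ => by ring
    rw [prod_range_succ', h, ih, pow_zero, mul_one, mul_add, sum_mul, sum_mul,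
      sum_range_succ' _ (n + 1)]
    have h2 : ∑ j ∈ range (n + 1), q ^ j.choose 2 * gaussBinom q n j * a ^ (n - j) * (b * q) ^ j * a
        = ∑ j ∈ range (n + 1), q ^ (j + 1).choose 2 * (q ^ (j + 1) * gaussBinom q n (j + 1)) *
            a ^ (n - j) * b ^ (j + 1) + a ^ (n + 1) := by
      rw [sum_range_succ', sum_range_succ _ n, gaussBinom_eq_zero_of_lt q n (n + 1) (by omega)]
      simp only [mul_zero, zero_mul, add_zero]
      congr 1
      · refine sum_congr rfl fun j hj => ?_
        obtain ⟨d, rfl⟩ := Nat.exists_eq_add_of_lt (mem_range.1 hj)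
        rw [show j + d + 1 - (j + 1) = d by omega, show j + d + 1 - j = d + 1 by omega]
        ring
      · simp [pow_succ]
    rw [h2, add_right_comm, ← sum_add_distrib]
    congr 1
    · refine sum_congr rfl fun j hj => ?_
      rw [gaussBinom_succ_succ, choose_two_succ, show n + 1 - (j + 1) = n - j by omega]
      ring
    · simp

end Gauss

/-! ### Rogers' recurrence for the series and for the alternating sums -/

section PowerSeries

variable {R : Type*} [CommRing R]

theorem constantCoeff_qPoch_X (n : ℕ) : constantCoeff (qPoch (X : R⟦X⟧) n) = 1 := by
  simp [qPoch, map_prod]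

/-- The inverse of `(1 - X) ⋯ (1 - X ^ n)`. -/
noncomputable def qPochInv (R : Type*) [CommRing R] (n : ℕ) : R⟦X⟧ := quo 1 (qPoch X n)

theorem qPochInv_mul (n : ℕ) : qPochInv R n * qPoch X n = 1 :=
  quo_mul_cancel _ _ (constantCoeff_qPoch_X n)

theorem qPochInv_eq_succ (n : ℕ) :
    qPochInv R n = qPochInv R (n + 1) * (1 - X ^ (n + 1)) := by
  have h1 := qPochInv_mul (R := R) n
  have h2 := qPochInv_mul (R := R) (n + 1)
  rw [qPoch_succ] at h2
  linear_combination (-qPochInv R n) * h2 + (qPochInv R (n + 1) * (1 - X ^ (n + 1))) * h1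

@[simp] theorem qPochInv_zero : qPochInv R 0 = 1 := by
  simpa using qPochInv_mul (R := R) 0

/-- The terms of the alternating series in Rogers' proof, at `a = X ^ (k + 1)`. -/
noncomputable def rogersTerm (R : Type*) [CommRing R] (k r : ℕ) : R⟦X⟧ :=
  (-1) ^ r * X ^ ((2 * k + 4) * r + 5 * r.choose 2) * (1 - X ^ (k + 1 + 2 * r)) *
    (qPoch X (k + r) * qPochInv R r)

/-- The boundary terms by which the recurrence of `rogersTerm` telescopes. -/
noncomputable def rogersBoundary (R : Type*) [CommRing R] (k r : ℕ) : R⟦X⟧ :=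
  (-1) ^ r * X ^ ((2 * k + 4) * r + 5 * r.choose 2) * (1 - X ^ r) *
    (qPoch X (k + r) + X ^ r * qPoch X (k + r + 1)) * qPochInv R r

/-- Over the common factor `qPoch X (k + r) * qPochInv R (r + 1)` this is a polynomial identity. -/
theorem rogersTerm_telescope (k r : ℕ) :
    rogersTerm R k r - rogersTerm R (k + 1) r - X ^ (k + 2) * rogersTerm R (k + 2) r =
      rogersBoundary R k r - rogersBoundary R k (r + 1) := by
  rw [rogersTerm, rogersTerm, rogersTerm, rogersBoundary, rogersBoundary,
    show k + 1 + r = k + r + 1 by omega, show k + 2 + r = k + r + 1 + 1 by omega,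
    show k + (r + 1) = k + r + 1 by omega, choose_two_succ, qPoch_succ _ (k + r + 1),
    qPoch_succ _ (k + r), qPochInv_eq_succ r]
  ring

theorem sum_rogersTerm (k N : ℕ) :
    ∑ r ∈ range N, rogersTerm R k r = ∑ r ∈ range N, rogersTerm R (k + 1) r +
      X ^ (k + 2) * ∑ r ∈ range N, rogersTerm R (k + 2) r - rogersBoundary R k N := by
  have h : ∑ r ∈ range N, (rogersTerm R k r - rogersTerm R (k + 1) r -
      X ^ (k + 2) * rogersTerm R (k + 2) r) = rogersBoundary R k 0 - rogersBoundary R k N := by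
    rw [← sum_range_sub']
    exact sum_congr rfl fun r _ => rogersTerm_telescope k r
  rw [sum_sub_distrib, sum_sub_distrib, ← mul_sum] at h
  have h0 : rogersBoundary R k 0 = 0 := by simp [rogersBoundary]
  linear_combination h + h0

/-- Partial sums of `∑ X ^ (m ^ 2 + (k + 1) m) / ((1 - X) ⋯ (1 - X ^ m))`. -/
noncomputable def rogersSum (R : Type*) [CommRing R] (k N : ℕ) : R⟦X⟧ :=
  ∑ m ∈ range N, X ^ (m * (m + (k + 1))) * qPochInv R m

/-- The difference of the terms of index m at k and k + 1 carries a factor 1 - X^m, which cancels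
the last factor of the denominator; then m shifts by one. -/
theorem rogersSum_succ (k N : ℕ) :
    rogersSum R k (N + 1) =
      rogersSum R (k + 1) (N + 1) + X ^ (k + 2) * rogersSum R (k + 2) N := by
  rw [rogersSum, rogersSum, rogersSum, sum_range_succ' _ N, sum_range_succ' _ N, mul_sum,
    add_right_comm, ← sum_add_distrib]
  congr 1
  · refine sum_congr rfl fun m _ => ?_
    rw [qPochInv_eq_succ m]
    ring

/-! ### Comparison modulo X^M -/

section Truncation

variable {M : ℕ}

/-- Reduction modulo `X ^ M`. -/
noncomputable abbrev modX (R : Type*) [CommRing R] (M : ℕ) :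
    R⟦X⟧ →+* R⟦X⟧ ⧸ Ideal.span {(X : R⟦X⟧) ^ M} :=
  Ideal.Quotient.mk _

theorem modX_eq_iff {f g : R⟦X⟧} : modX R M f = modX R M g ↔ X ^ M ∣ f - g := by
  rw [Ideal.Quotient.mk_eq_mk_iff_sub_mem, Ideal.mem_span_singleton]

theorem modX_X_pow {n : ℕ} (h : M ≤ n) : modX R M X ^ n = 0 := by
  rw [← map_pow, ← map_zero (modX R M), modX_eq_iff, sub_zero]
  exact pow_dvd_pow _ h

theorem isUnit_of_constantCoeff_eq_one {f : R⟦X⟧} (h : constantCoeff f = 1) : IsUnit f :=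
  isUnit_iff_constantCoeff.2 (h ▸ isUnit_one)

theorem modX_qPoch {c n : ℕ} (hc : c ≠ 0) (h : M ≤ n) :
    modX R M (qPoch (X ^ c) n) = modX R M (qPoch (X ^ c) M) := by
  induction n, h using Nat.le_induction with
  | base => rfl
  | succ n h ih =>
    have : M ≤ c * (n + 1) := by nlinarith [Nat.pos_of_ne_zero hc]
    rw [qPoch_succ, map_mul, ih, map_sub, map_one, ← pow_mul, map_pow, modX_X_pow this, sub_zero,
      mul_one]

theorem modX_qPoch_X {n : ℕ} (h : M ≤ n) :
    modX R M (qPoch X n) = modX R M (qPoch X M) := by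
  simpa using modX_qPoch (R := R) one_ne_zero h

/-- Downward induction on k: both sides obey the same recurrence modulo X^M, and once k ≥ M only
their terms of index 0 survive. -/
theorem modX_sum_rogersTerm (k : ℕ) {N : ℕ} (hN : M < N) :
    modX R M (∑ r ∈ range N, rogersTerm R k r) = modX R M (qPoch X M * rogersSum R k N) := by
  suffices ∀ d k, M ≤ k + d → modX R M (∑ r ∈ range N, rogersTerm R k r) =
      modX R M (qPoch X M * rogersSum R k N) from this M k (by omega)
  obtain ⟨N, rfl⟩ : ∃ n, N = n + 1 := ⟨N - 1, by omega⟩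
  intro d
  induction d with
  | zero =>
    intro k hk
    rw [rogersSum, sum_range_succ', sum_range_succ', map_add, map_mul, map_add, map_sum, map_sum,
      sum_eq_zero, sum_eq_zero]
    · have : rogersTerm R k 0 = qPoch X (k + 1) := by
        simp [rogersTerm, qPoch_succ, mul_comm]
      rw [this, modX_qPoch_X (by omega)]
      simp
    · intro m _
      rw [map_mul, map_pow, modX_X_pow (by nlinarith), zero_mul]
    · intro r _
      rw [rogersTerm, mul_assoc, mul_assoc, map_mul, map_mul, map_pow _ X, modX_X_pow (by nlinarith)]
      simp
  | succ d ih =>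
    intro k hk
    have hb : modX R M (rogersBoundary R k (N + 1)) = 0 := by
      rw [rogersBoundary, mul_assoc, mul_assoc, mul_assoc, map_mul, map_mul, map_pow _ X,
        modX_X_pow (by nlinarith)]
      simp
    -- `rogersSum_succ` shortens the second sum by one term; that term is 0 modulo X^M since N ≥ M.
    have hg : modX R M (rogersSum R (k + 2) (N + 1)) = modX R M (rogersSum R (k + 2) N) := by
      rw [rogersSum, sum_range_succ, map_add, map_mul, map_pow, modX_X_pow (by nlinarith), zero_mul,
        add_zero, rogersSum]
    rw [sum_rogersTerm, map_sub, hb, sub_zero, map_add, map_mul, ih _ (by omega), ih _ (by omega),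
      rogersSum_succ k]
    simp only [map_add, map_mul, hg]
    ring

end Truncation

/-! ### The triple product and the unweighted identity -/

/-- A finite form of the Jacobi triple product for the residues `1` and `4` modulo `5`. -/
theorem finite_triple_product (n : ℕ) :
    (∏ l ∈ range (n + 1), (1 - X ^ (5 * l + 1))) * ∏ l ∈ range n, (1 - X ^ (5 * l + 4)) =
      ∑ r ∈ range (n + 1), ((-1) ^ r * X ^ (4 * r + 5 * r.choose 2) *
        (gaussBinom (X ^ 5 : R⟦X⟧) (2 * n + 1) (n + 1 + r) -
          X ^ (2 * r + 1) * gaussBinom (X ^ 5) (2 * n + 1) (n - r))) := by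
  -- The factors X^(5i) - X^(5n+1) give exponents 5l + 1 for i ≤ n and 5l + 4 for i > n, up to signs
  -- and powers of X. On the sum side, the indices n - r and n + 1 + r are paired.
  have key := prod_add_mul_pow (X ^ 5 : R⟦X⟧) (-X ^ (5 * n + 1)) 1 (2 * n + 1)
  rw [show 2 * n + 1 = (n + 1) + n by omega, prod_range_add,
    show (n + 1) + n + 1 = (n + 1) + (n + 1) by omega, sum_range_add,
    ← sum_range_reflect _ (n + 1), ← sum_add_distrib, ← prod_range_reflect _ (n + 1)] at key
  have h1 : ∏ j ∈ range (n + 1), (-X ^ (5 * n + 1) + 1 * (X ^ 5 : R⟦X⟧) ^ (n + 1 - 1 - j)) =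
      X ^ (5 * (n + 1).choose 2) * ∏ l ∈ range (n + 1), (1 - X ^ (5 * l + 1)) := by
    have hc : (n + 1).choose 2 = ∑ j ∈ range (n + 1), (n + 1 - 1 - j) := by
      rw [sum_range_reflect (fun i => i), sum_range_id, Nat.choose_two_right]
    rw [hc, mul_sum, ← prod_pow_eq_pow_sum, ← prod_mul_distrib]
    refine prod_congr rfl fun j hj => ?_
    obtain ⟨d, rfl⟩ := Nat.exists_eq_add_of_le (Nat.lt_succ_iff.1 (mem_range.1 hj))
    rw [show j + d + 1 - 1 - j = d by omega]
    ring
  have h2 : ∏ i ∈ range n, (-X ^ (5 * n + 1) + 1 * (X ^ 5 : R⟦X⟧) ^ (n + 1 + i)) =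
      (-1) ^ n * X ^ ((5 * n + 1) * n) * ∏ l ∈ range n, (1 - X ^ (5 * l + 4)) := by
    rw [pow_mul, ← mul_pow, ← card_range n, ← prod_const, card_range, ← prod_mul_distrib]
    exact prod_congr rfl fun i _ => by ring
  rw [h1, h2] at key
  apply X_pow_mul_cancel (k := 5 * (n + 1).choose 2 + (5 * n + 1) * n)
  have hs : ((-1) ^ n * (-1) ^ n : R⟦X⟧) = 1 := by rw [← mul_pow]; simp
  calc X ^ (5 * (n + 1).choose 2 + (5 * n + 1) * n) *
        ((∏ l ∈ range (n + 1), (1 - (X : R⟦X⟧) ^ (5 * l + 1))) *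
          ∏ l ∈ range n, (1 - X ^ (5 * l + 4))) = (-1) ^ n * (X ^ (5 * (n + 1).choose 2) * (∏ l ∈ range (n + 1), (1 - X ^ (5 * l + 1))) *
        ((-1) ^ n * X ^ ((5 * n + 1) * n) * ∏ l ∈ range n, (1 - X ^ (5 * l + 4)))) := by
        rw [pow_add]
        linear_combination (-(X ^ (5 * (n + 1).choose 2) * X ^ ((5 * n + 1) * n) *
          (∏ l ∈ range (n + 1), (1 - X ^ (5 * l + 1))) *
          ∏ l ∈ range n, (1 - X ^ (5 * l + 4)))) * hs
    _ = _ := by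
        rw [key, mul_sum, mul_sum]
        refine sum_congr rfl fun r hr => ?_
        obtain ⟨d, rfl⟩ := Nat.exists_eq_add_of_le (Nat.lt_succ_iff.1 (mem_range.1 hr))
        rw [show r + d + 1 - 1 - r = d by omega, show r + d - r = d by omega,
          show r + d + 1 + (r + d) - d = 2 * r + d + 1 by omega,
          show r + d + 1 + (r + d) - (r + d + 1 + r) = d by omega, neg_pow, neg_pow (X ^ _) d]
        have hd : ((-1) ^ d * (-1) ^ d : R⟦X⟧) = 1 := by rw [← mul_pow]; simp
        have hr : ((-1) ^ r * (-1) ^ r : R⟦X⟧) = 1 := by rw [← mul_pow]; simp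
        -- Makes the quadratic exponent identities `e1` and `e2` linear.
        have hC : r * r = 2 * r.choose 2 + r := by
          clear * -
          induction r with
          | zero => rfl
          | succ r ih => rw [choose_two_succ]; linarith
        have e1 : 5 * d.choose 2 + (5 * (r + d) + 1) * (2 * r + d + 1) =
            5 * (r + d + 1).choose 2 + (5 * (r + d) + 1) * (r + d) +
              (4 * r + 5 * r.choose 2) + (2 * r + 1) := by
          simp only [choose_two_succ, choose_two_add]
          linarith
        have e2 : 5 * (r + d + 1 + r).choose 2 + (5 * (r + d) + 1) * d =
            5 * (r + d + 1).choose 2 + (5 * (r + d) + 1) * (r + d) +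
              (4 * r + 5 * r.choose 2) := by
          simp only [choose_two_succ, choose_two_add]
          linarith
        have f1 := congrArg (fun e => (X : R⟦X⟧) ^ e) e1
        have f2 := congrArg (fun e => (X : R⟦X⟧) ^ e) e2
        rw [pow_add _ _ (2 * r + 1)] at f1
        rw [pow_add _ _ (4 * r + 5 * r.choose 2), pow_add _ (5 * d.choose 2)] at f1
        rw [pow_add _ _ (4 * r + 5 * r.choose 2), pow_add _ (5 * (r + d + 1 + r).choose 2)] at f2
        have s1 : ((-1) ^ (r + d) * (-1) ^ (2 * r + d + 1) : R⟦X⟧) = -(-1) ^ r := by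
          linear_combination (-(-1) ^ r * (-1) ^ d * (-1) ^ d) * hr - (-1) ^ r * hd
        have s2 : ((-1) ^ (r + d) * (-1) ^ d : R⟦X⟧) = (-1) ^ r := by
          linear_combination (-1) ^ r * hd
        simp only [one_pow, mul_one, ← pow_mul]
        rw [show r + d + 1 + (r + d) = 2 * (r + d) + 1 by omega]
        linear_combination (X ^ (5 * d.choose 2) * gaussBinom (X ^ 5) (2 * (r + d) + 1) d *
            X ^ ((5 * (r + d) + 1) * (2 * r + d + 1))) * s1 +
          (X ^ (5 * (r + d + 1 + r).choose 2) *
            gaussBinom (X ^ 5) (2 * (r + d) + 1) (r + d + 1 + r) *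
            X ^ ((5 * (r + d) + 1) * d)) * s2 -
          (-1) ^ r * gaussBinom (X ^ 5) (2 * (r + d) + 1) d * f1 +
          (-1) ^ r * gaussBinom (X ^ 5) (2 * (r + d) + 1) (r + d + 1 + r) * f2

/-- If r < M, both lower indices and their complements are at least M, so each binomial is already
1/(q⁵; q⁵)_∞ modulo X^M. Otherwise the power of X in front kills the term. -/
theorem modX_eq_zero_or_gaussBinom {M n r : ℕ} (hn : 2 * M ≤ n) (hr : r ≤ n) :
    modX R M X ^ r = 0 ∨
      modX R M (gaussBinom (X ^ 5) (2 * n + 1) (n + 1 + r) * qPoch (X ^ 5) M) = 1 ∧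
      modX R M (gaussBinom (X ^ 5) (2 * n + 1) (n - r) * qPoch (X ^ 5) M) = 1 := by
  rcases le_or_gt M r with h | h
  · exact Or.inl (modX_X_pow h)
  right
  have hu : IsUnit (modX R M (qPoch (X ^ 5) M)) := by
    refine (isUnit_of_constantCoeff_eq_one ?_).map _
    simp [qPoch, map_prod, ← pow_mul]
  have main (i j : ℕ) (hi : M ≤ i) (hj : M ≤ j) :
      modX R M (gaussBinom (X ^ 5) (i + j) j * qPoch (X ^ 5) M) = 1 := by
    have h := congrArg (modX R M) (gaussBinom_mul_qPoch (X ^ 5) i j)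
    rw [map_mul, map_mul, modX_qPoch (by norm_num) hi, modX_qPoch (by norm_num) hj,
      modX_qPoch (by norm_num) (by omega : M ≤ i + j)] at h
    apply hu.mul_right_cancel
    rw [map_mul]
    linear_combination h
  constructor
  · simpa [show n - r + (n + 1 + r) = 2 * n + 1 by omega] using
      main (n - r) (n + 1 + r) (by omega) (by omega)
  · simpa [show n + 1 + r + (n - r) = 2 * n + 1 by omega] using
      main (n + 1 + r) (n - r) (by omega) (by omega)

theorem modX_triple_product {M n : ℕ} (hn : 2 * M ≤ n) :
    modX R M ((∏ l ∈ range (n + 1), (1 - X ^ (5 * l + 1))) *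
      (∏ l ∈ range n, (1 - X ^ (5 * l + 4))) * qPoch (X ^ 5) M) =
    modX R M (∑ r ∈ range (n + 1), rogersTerm R 0 r) := by
  rw [finite_triple_product, sum_mul, map_sum, map_sum]
  refine sum_congr rfl fun r hr => ?_
  have hP : qPoch X r * qPochInv R r = 1 := by rw [mul_comm, qPochInv_mul]
  simp only [rogersTerm, zero_add, mul_zero, hP, mul_one, map_mul, map_pow]
  rcases modX_eq_zero_or_gaussBinom (R := R) hn (Nat.lt_succ_iff.1 (mem_range.1 hr)) with h | h
  · rw [show 4 * r + 5 * r.choose 2 = r + (3 * r + 5 * r.choose 2) by ring, pow_add, h]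
    ring
  · simp only [map_mul, map_pow, map_sub, map_one] at h ⊢
    linear_combination (modX R M (-1) ^ r * modX R M X ^ (4 * r + 5 * r.choose 2)) *
      (h.1 - modX R M X ^ (2 * r + 1) * h.2)

/-- Sorting the exponents by residue modulo 5 leaves the residues 2 and 3 once the triple product is
cancelled. -/
theorem qPoch_X_five_mul (n : ℕ) :
    qPoch (X : R⟦X⟧) (5 * n) = (∏ l ∈ range n, (1 - X ^ (5 * l + 1))) *
      (∏ l ∈ range n, (1 - X ^ (5 * l + 4))) * qPoch (X ^ 5) n *
      ∏ l ∈ range n, ((1 - X ^ (5 * l + 2)) * (1 - X ^ (5 * l + 3))) := by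
  induction n with
  | zero => simp
  | succ n ih =>
    rw [show 5 * (n + 1) = 5 * n + 1 + 1 + 1 + 1 + 1 by ring]
    simp only [qPoch_succ, prod_range_succ, ih]
    ring

/-- The second Rogers–Ramanujan identity modulo `X ^ M`. -/
theorem modX_rogersRamanujan {M n : ℕ} (hn : 2 * M ≤ n) :
    modX R M (rogersSum R 0 (n + 1) *
      ∏ l ∈ range n, ((1 - X ^ (5 * l + 2)) * (1 - X ^ (5 * l + 3)))) = 1 := by
  have h1 := modX_triple_product (R := R) hn
  rw [modX_sum_rogersTerm 0 (by omega), prod_range_succ] at h1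
  have h2 := congrArg (modX R M) (qPoch_X_five_mul (R := R) n)
  have hu : IsUnit (modX R M (qPoch X M)) :=
    (isUnit_of_constantCoeff_eq_one (constantCoeff_qPoch_X M)).map _
  have h3 : modX R M (1 - X ^ (5 * n + 1)) = 1 := by
    rw [map_sub, map_pow, modX_X_pow (by omega)]; simp
  rw [modX_qPoch_X (by omega)] at h2
  simp only [map_mul, h3] at h1 h2 ⊢
  rw [modX_qPoch (by norm_num) (by omega : M ≤ n)] at h2
  apply hu.mul_left_cancel
  rw [← mul_assoc, ← h1, mul_one, mul_one]
  exact h2.symm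

/-! ### The weights -/

theorem quo_mul_eq {a b c a' b' : R⟦X⟧} (hb : constantCoeff b = 1) (hb' : constantCoeff b' = 1)
    (h : a * c * b' = a' * b) : quo a b * c = quo a' b' := by
  apply ((isUnit_of_constantCoeff_eq_one hb).mul (isUnit_of_constantCoeff_eq_one hb')).mul_right_cancel
  linear_combination (c * b') * quo_mul_cancel a b hb - b * quo_mul_cancel a' b' hb' + h

theorem quo_one_right (a : R⟦X⟧) : quo a 1 = a := by
  simpa using quo_mul_cancel a 1 (by simp)

theorem constantCoeff_factor (c : R) (k : ℕ) : constantCoeff (factor c (k + 1)) = 1 := by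
  simp [factor]

theorem constantCoeff_weightedPoch (t w v : R) (m : ℕ) :
    constantCoeff (weightedPoch t w v m) = 1 := by
  rw [weightedPoch, map_prod]
  refine prod_eq_one fun k hk => ?_
  obtain ⟨k, rfl⟩ := Nat.exists_eq_add_of_le' (mem_Icc.1 hk).1
  exact constantCoeff_factor _ _

/-- The product of the factors that carry a weight. -/
noncomputable def weightedFactors (t w v : R) : R⟦X⟧ :=
  (1 - C t * X ^ 2) * (1 - C w * X ^ 3) * (1 - C v * X ^ 7)

theorem constantCoeff_weightedFactors (t w v : R) :
    constantCoeff (weightedFactors t w v) = 1 := by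
  simp [weightedFactors]

theorem factor_partWeight_of_lt (t w v : R) {k : ℕ} (h : 7 < k) :
    factor (partWeight t w v k) k = 1 - X ^ k := by
  simp [factor, partWeight, show k ≠ 2 by omega, show k ≠ 3 by omega, show k ≠ 7 by omega]

theorem weightedPoch_mul_weightedFactors (t w v : R) (m : ℕ) :
    weightedPoch t w v (m + 7) * weightedFactors 1 1 1 =
      qPoch X (m + 7) * weightedFactors t w v := by
  induction m with
  | zero =>
    simp [weightedPoch, weightedFactors, qPoch, prod_range_succ, factor, partWeight,
      prod_Icc_succ_top]
    ring
  | succ m ih =>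
    rw [show m + 1 + 7 = m + 7 + 1 by ring, weightedPoch, prod_Icc_succ_top (by omega),
      ← weightedPoch, factor_partWeight_of_lt t w v (by omega), qPoch_succ]
    linear_combination (1 - X ^ (m + 7 + 1)) * ih

theorem prod_productFactor_mul_weightedFactors (t w v : R) (n : ℕ) :
    (∏ k ∈ range (n + 2), productFactor t w v k) * weightedFactors 1 1 1 =
      (∏ k ∈ range (n + 2), ((1 - X ^ (5 * k + 2)) * (1 - X ^ (5 * k + 3)))) *
        weightedFactors t w v := by
  induction n with
  | zero =>
    simp [weightedFactors, prod_range_succ, factor, partWeight, productFactor]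
    ring
  | succ n ih =>
    rw [show n + 1 + 2 = n + 2 + 1 by ring, prod_range_succ, prod_range_succ _ (n + 2),
      productFactor, factor_partWeight_of_lt t w v (by omega),
      factor_partWeight_of_lt t w v (by omega)]
    linear_combination ((1 - X ^ (5 * (n + 2) + 2)) * (1 - X ^ (5 * (n + 2) + 3))) * ih

/-- The terms of index below `7` of the weighted series. -/
noncomputable def headSum (t w v : R) : R⟦X⟧ :=
  1 + X ^ 2 * quo (C t + C w * X) (1 - C t * X ^ 2)
    + X ^ 6 * quo (C w ^ 2 + C v * X + X ^ 2) ((1 - C t * X ^ 2) * (1 - C w * X ^ 3))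
    + X ^ 12 * quo (1 + X + C v ^ 2 * X ^ 2 + C v * X ^ 3 + X ^ 4 + X ^ 5 + X ^ 6)
        ((1 - C t * X ^ 2) * (1 - C w * X ^ 3) * (1 - C v * X ^ 7))
    + X ^ 20 * quo (1 + X + X ^ 2 + X ^ 3 + X ^ 4 + X ^ 5 + X ^ 6)
        ((1 - C t * X ^ 2) * (1 - C w * X ^ 3) * (1 - X ^ 4) * (1 - C v * X ^ 7))
    + X ^ 30 * quo (1 + X + X ^ 2 + X ^ 3 + X ^ 4 + X ^ 5 + X ^ 6)
        ((1 - C t * X ^ 2) * (1 - C w * X ^ 3) * (1 - X ^ 4) * (1 - X ^ 5) * (1 - C v * X ^ 7))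
    + X ^ 42 * quo (1 + X + X ^ 2 + X ^ 3 + X ^ 4 + X ^ 5 + X ^ 6)
        ((1 - C t * X ^ 2) * (1 - C w * X ^ 3) * (1 - X ^ 4) * (1 - X ^ 5) * (1 - X ^ 6) *
          (1 - C v * X ^ 7))

/-- The terms of index 4, 5, 6 agree one by one. Those of index 0 to 3 agree only in sum: they
telescope to 1 + X⁸ + X¹² + X¹³ + X¹⁶ + X¹⁷ + X¹⁸, free of t, w, v. -/
theorem headSum_mul_weightedFactors (t w v : R) :
    headSum t w v * weightedFactors t w v = rogersSum R 0 7 * weightedFactors 1 1 1 := by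
  have a1 : quo (C t + C w * X) (1 - C t * X ^ 2) * weightedFactors t w v =
      quo ((C t + C w * X) * ((1 - C w * X ^ 3) * (1 - C v * X ^ 7))) 1 :=
    quo_mul_eq (by simp) (by simp) (by rw [weightedFactors]; ring)
  have a2 : quo (C w ^ 2 + C v * X + X ^ 2) ((1 - C t * X ^ 2) * (1 - C w * X ^ 3)) *
      weightedFactors t w v = quo ((C w ^ 2 + C v * X + X ^ 2) * (1 - C v * X ^ 7)) 1 :=
    quo_mul_eq (by simp) (by simp) (by rw [weightedFactors]; ring)
  have a3 : quo (1 + X + C v ^ 2 * X ^ 2 + C v * X ^ 3 + X ^ 4 + X ^ 5 + X ^ 6)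
        ((1 - C t * X ^ 2) * (1 - C w * X ^ 3) * (1 - C v * X ^ 7)) * weightedFactors t w v =
      quo (1 + X + C v ^ 2 * X ^ 2 + C v * X ^ 3 + X ^ 4 + X ^ 5 + X ^ 6) 1 :=
    quo_mul_eq (by simp) (by simp) (by rw [weightedFactors]; ring)
  have a4 : quo (1 + X + X ^ 2 + X ^ 3 + X ^ 4 + X ^ 5 + X ^ 6)
        ((1 - C t * X ^ 2) * (1 - C w * X ^ 3) * (1 - X ^ 4) * (1 - C v * X ^ 7)) *
        weightedFactors t w v = quo (weightedFactors 1 1 1) (qPoch X 4) :=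
    quo_mul_eq (by simp) (constantCoeff_qPoch_X _)
      (by simp [weightedFactors, qPoch, prod_range_succ]; ring)
  have a5 : quo (1 + X + X ^ 2 + X ^ 3 + X ^ 4 + X ^ 5 + X ^ 6)
        ((1 - C t * X ^ 2) * (1 - C w * X ^ 3) * (1 - X ^ 4) * (1 - X ^ 5) * (1 - C v * X ^ 7)) *
        weightedFactors t w v = quo (weightedFactors 1 1 1) (qPoch X 5) :=
    quo_mul_eq (by simp) (constantCoeff_qPoch_X _)
      (by simp [weightedFactors, qPoch, prod_range_succ]; ring)
  have a6 : quo (1 + X + X ^ 2 + X ^ 3 + X ^ 4 + X ^ 5 + X ^ 6)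
        ((1 - C t * X ^ 2) * (1 - C w * X ^ 3) * (1 - X ^ 4) * (1 - X ^ 5) * (1 - X ^ 6) *
          (1 - C v * X ^ 7)) * weightedFactors t w v = quo (weightedFactors 1 1 1) (qPoch X 6) :=
    quo_mul_eq (by simp) (constantCoeff_qPoch_X _)
      (by simp [weightedFactors, qPoch, prod_range_succ]; ring)
  have b (m : ℕ) : qPochInv R m * weightedFactors 1 1 1 =
      quo (weightedFactors 1 1 1) (qPoch X m) :=
    quo_mul_eq (constantCoeff_qPoch_X _) (constantCoeff_qPoch_X _) (by ring)
  have c1 : qPochInv R 1 * weightedFactors 1 1 1 =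
      quo ((1 + X) * ((1 - X ^ 3) * (1 - X ^ 7))) 1 :=
    quo_mul_eq (constantCoeff_qPoch_X _) (by simp)
      (by simp [weightedFactors, qPoch]; ring)
  have c2 : qPochInv R 2 * weightedFactors 1 1 1 = quo ((1 + X + X ^ 2) * (1 - X ^ 7)) 1 :=
    quo_mul_eq (constantCoeff_qPoch_X _) (by simp)
      (by simp [weightedFactors, qPoch, prod_range_succ]; ring)
  have c3 : qPochInv R 3 * weightedFactors 1 1 1 =
      quo (1 + X + X ^ 2 + X ^ 3 + X ^ 4 + X ^ 5 + X ^ 6) 1 :=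
    quo_mul_eq (constantCoeff_qPoch_X _) (by simp)
      (by simp [weightedFactors, qPoch, prod_range_succ]; ring)
  rw [quo_one_right] at a1 a2 a3 c1 c2 c3
  have hd (t w v : R) : weightedFactors t w v =
    (1 - C t * X ^ 2) * (1 - C w * X ^ 3) * (1 - C v * X ^ 7) := rfl
  have hd1 := hd 1 1 1
  rw [map_one] at hd1
  have z : rogersSum R 0 7 = 1 + X ^ 2 * qPochInv R 1 + X ^ 6 * qPochInv R 2 +
      X ^ 12 * qPochInv R 3 + X ^ 20 * qPochInv R 4 + X ^ 30 * qPochInv R 5 +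
      X ^ 42 * qPochInv R 6 := by
    simp [rogersSum, sum_range_succ]
  rw [z, headSum]
  linear_combination X ^ 2 * a1 + X ^ 6 * a2 + X ^ 12 * a3 + X ^ 20 * (a4 - b 4) +
    X ^ 30 * (a5 - b 5) + X ^ 42 * (a6 - b 6) - X ^ 2 * c1 - X ^ 6 * c2 - X ^ 12 * c3 +
    hd t w v - hd1

theorem headSum_add_sum_mul_weightedFactors (t w v : R) (N : ℕ) :
    (headSum t w v + ∑ m ∈ range N, tailTerm t w v (m + 7)) * weightedFactors t w v =
      rogersSum R 0 (7 + N) * weightedFactors 1 1 1 := by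
  rw [add_mul, headSum_mul_weightedFactors, rogersSum, rogersSum, sum_range_add, add_mul]
  simp only [sum_mul]
  refine congrArg _ (sum_congr rfl fun m _ => ?_)
  rw [tailTerm, qPochInv, add_comm 7 m,
    quo_mul_eq (constantCoeff_weightedPoch t w v _) (constantCoeff_qPoch_X (m + 7))
      (a' := X ^ ((m + 7) * (m + 7 + 1)) * weightedFactors 1 1 1)
      (by linear_combination (-X ^ ((m + 7) * (m + 7 + 1))) *
        weightedPoch_mul_weightedFactors t w v m), mul_assoc,
    quo_mul_eq (a' := weightedFactors 1 1 1) (constantCoeff_qPoch_X (m + 7))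
      (constantCoeff_qPoch_X (m + 7)) (by ring)]
  rw [quo, quo, mul_assoc]

/-- The weighted identity modulo `X ^ M`. -/
theorem modX_weighted (t w v : R) {M n : ℕ} (hn : 2 * M ≤ n) :
    modX R M ((headSum t w v + ∑ m ∈ range n, tailTerm t w v (m + 7)) *
      ∏ k ∈ range (n + 6), productFactor t w v k) = 1 := by
  have h1 := congrArg (modX R M) (headSum_add_sum_mul_weightedFactors t w v n)
  have h2 := congrArg (modX R M) (prod_productFactor_mul_weightedFactors t w v (n + 4))
  -- The 7 head terms and n tail terms make n + 7 = (n + 6) + 1 terms, hence the n + 6 factors in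
  -- the product.
  have h3 := modX_rogersRamanujan (R := R) (M := M) (n := n + 6) (by omega)
  rw [show n + 6 + 1 = 7 + n by ring] at h3
  rw [show n + 4 + 2 = n + 6 by ring] at h2
  have hu : IsUnit (modX R M (weightedFactors 1 1 1)) :=
    (isUnit_of_constantCoeff_eq_one (constantCoeff_weightedFactors 1 1 1)).map _
  apply hu.mul_left_cancel
  simp only [map_mul] at h1 h2 h3 ⊢
  linear_combination modX R M (headSum t w v + ∑ m ∈ range n, tailTerm t w v (m + 7)) * h2 +
    modX R M (∏ l ∈ range (n + 6), ((1 - X ^ (5 * l + 2)) * (1 - X ^ (5 * l + 3)))) * h1 +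
    modX R M (weightedFactors 1 1 1) * h3

/-! ### Convergence and passage to the limit -/

section Limits

open Filter

variable [TopologicalSpace R]

theorem summable_tailTerm (t w v : R) : Summable fun m : ℕ => tailTerm t w v (m + 7) := by
  apply WithPiTopology.summable_of_tendsto_order_atTop_nhds_top
  refine ENat.tendsto_nhds_top_iff_natCast_lt.mpr fun n => eventually_atTop.mpr ⟨n, fun m hm => ?_⟩
  refine lt_of_lt_of_le ?_ (nat_le_order _ ((m + 7) * (m + 7 + 1)) (X_pow_dvd_iff.1 (Dvd.intro _ rfl)))
  exact_mod_cast (by nlinarith : n < (m + 7) * (m + 7 + 1))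

theorem multipliable_productFactor (t w v : R) :
    Multipliable fun k : ℕ => productFactor t w v k := by
  have h := WithPiTopology.multipliable_one_add_of_tendsto_order_atTop_nhds_top R
    (f := fun k => productFactor t w v k - 1) ?_
  · simpa using h
  refine ENat.tendsto_nhds_top_iff_natCast_lt.mpr fun n => eventually_atTop.mpr ⟨n, fun k hk => ?_⟩
  refine lt_of_lt_of_le ?_ (nat_le_order _ (5 * k + 2) (X_pow_dvd_iff.1 ?_))
  · exact_mod_cast (by omega : n < 5 * k + 2)
  · refine ⟨-C (partWeight t w v (5 * k + 2)) - X * C (partWeight t w v (5 * k + 3)) *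
      factor (partWeight t w v (5 * k + 2)) (5 * k + 2), ?_⟩
    rw [productFactor, factor, factor]
    ring

variable [DiscreteTopology R]

theorem constantCoeff_tprod_productFactor (t w v : R) :
    constantCoeff (∏' k : ℕ, productFactor t w v k) = 1 := by
  have h := ((WithPiTopology.continuous_constantCoeff R).tendsto _).comp
    (multipliable_productFactor t w v).hasProd.tendsto_prod_nat
  refine tendsto_nhds_unique h (tendsto_const_nhds.congr fun n => ?_)
  simp [map_prod, productFactor, factor]

theorem headSum_add_tsum_mul_tprod (t w v : R) :
    (headSum t w v + ∑' m : ℕ, tailTerm t w v (m + 7)) * ∏' k : ℕ, productFactor t w v k = 1 := by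
  have h1 := ((summable_tailTerm t w v).hasSum.tendsto_sum_nat.const_add (headSum t w v)).mul
    ((tendsto_add_atTop_iff_nat 6).2
      (multipliable_productFactor t w v).hasProd.tendsto_prod_nat)
  refine tendsto_nhds_unique h1 ((WithPiTopology.tendsto_iff_coeff_tendsto R _ _ _).2 fun d => ?_)
  -- The coefficient of X^d is determined modulo X^(d+1), so `modX_weighted` applies with M = d + 1.
  refine tendsto_atTop_of_eventually_const (i₀ := 2 * (d + 1)) fun n hn => ?_
  have h := modX_weighted t w v hn
  rw [← map_one (modX R (d + 1)), modX_eq_iff, X_pow_dvd_iff] at h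
  exact sub_eq_zero.1 (by simpa using h d (Nat.lt_succ_self d))

end Limits

end PowerSeries

end RRWeighted

theorem mainTheorem9 {R : Type*} [CommRing R] [TopologicalSpace R] [DiscreteTopology R]
    (t w v : R) :
    Summable (fun m : ℕ => tailTerm t w v (m + 7)) ∧
    Multipliable (fun k : ℕ => productFactor t w v k) ∧
    1 + X ^ 2 * quo (C t + C w * X) (1 - C t * X ^ 2)
      + X ^ 6 * quo (C w ^ 2 + C v * X + X ^ 2) ((1 - C t * X ^ 2) * (1 - C w * X ^ 3))
      + X ^ 12 * quo (1 + X + C v ^ 2 * X ^ 2 + C v * X ^ 3 + X ^ 4 + X ^ 5 + X ^ 6)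
          ((1 - C t * X ^ 2) * (1 - C w * X ^ 3) * (1 - C v * X ^ 7))
      + X ^ 20 * quo (1 + X + X ^ 2 + X ^ 3 + X ^ 4 + X ^ 5 + X ^ 6)
          ((1 - C t * X ^ 2) * (1 - C w * X ^ 3) * (1 - X ^ 4) * (1 - C v * X ^ 7))
      + X ^ 30 * quo (1 + X + X ^ 2 + X ^ 3 + X ^ 4 + X ^ 5 + X ^ 6)
          ((1 - C t * X ^ 2) * (1 - C w * X ^ 3) * (1 - X ^ 4) * (1 - X ^ 5) * (1 - C v * X ^ 7))
      + X ^ 42 * quo (1 + X + X ^ 2 + X ^ 3 + X ^ 4 + X ^ 5 + X ^ 6)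
          ((1 - C t * X ^ 2) * (1 - C w * X ^ 3) * (1 - X ^ 4) * (1 - X ^ 5) * (1 - X ^ 6) *
            (1 - C v * X ^ 7))
      + ∑' m : ℕ, tailTerm t w v (m + 7)
    = quo 1 (∏' k : ℕ, productFactor t w v k) := by
  refine ⟨summable_tailTerm t w v, multipliable_productFactor t w v, ?_⟩
  have hZ := constantCoeff_tprod_productFactor t w v
  apply (isUnit_of_constantCoeff_eq_one hZ).mul_right_cancel
  rw [quo_mul_cancel _ _ hZ]
  exact headSum_add_tsum_mul_tprod t w v
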